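/- Let $f:\mathbb R^{n_x}\times\mathbb R^{n_u}\to\mathbb R^{n_x}$, let $B_d\in\mathbb R^{n_x}$ be nonzero, $\mathcal Z=\{(x,u): h(x,u)\le 0\}$ and $\mathcal Z_{\mathrm f}=\{x: h_H(x)\le 0\}$ (vector-valued $h,h_H$, componentwise inequalities). The true system is $x(k+1)=f(x(k),u(k))+B_d\,g^{\mathrm{tr}}(x(k),u(k))$. The unknown scalar function $g^{\mathrm{tr}}$ lies in the reproducing kernel Hilbert space $\mathcal H_k$ of a continuous positive (semi)definite kernel $k$ on $\mathbb R^{n_x}\times\mathbb R^{n_u}$, and $\|g^{\mathrm{tr}}\|_{\mathcal H_k}\le B_g$. Data: for $i=1,\dots,D$ one observes $y_i=B_d^\dagger\big(x_i^+-f(z_i)\big)+\epsilon_i$, where $x_i^+=f(z_i)+B_d\,g^{\mathrm{tr}}(z_i)$, the $\epsilon_i$ are i.i.d. $\mathcal N(0,\lambda^2)$ with $\lambda>0$, and the inputs $z_i$ lie in a set $S$; each $z_i$ may depend on the past, but not on $\epsilon_i,\epsilon_{i+1},\dots,\epsilon_D$. Write $Z=(z_i)_i$, $Y=(y_i)_i$,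 $\tilde K=k(Z,Z)+\lambda^2I$, and $$\mu(z)=k(z,Z)\tilde K^{-1}Y,\qquad \sigma^2(z,z')=k(z,z')-k(z,Z)\tilde K^{-1}k(Z,z'),\qquad \sigma(z)=\sqrt{\sigma^2(z,z)} .$$ Let $p\in(0,1)$, assume that the maximum information gain $\gamma_D=\sup_{A\in S^D}\tfrac12\log\det\big(I+\lambda^{-2}k(A,A)\big)$ is finite, and let $\beta$ satisfy $$\sqrt\beta\ \ge\ B_g+\sqrt{2\big(\gamma_D+1+\log(1/p)\big)} .$$ Define the confidence set $\mathcal G=\{g:\ |g(z)-\mu(z)|\le\sqrt\beta\,\sigma(z)\ \ \forall z\in\mathcal Z\}$. Fix a horizon $H$ and stage costs $l_0,\dots,l_{H-1}$. For an initial state $x_0$, the robust optimal control problem is to minimize $\mathbb E\big[\sum_{i=0}^{H-1}l_i(x_i^g,u_i)\big]$ over $(u_0,\dots,u_{H-1})$, where $g$ is distributed as the Gaussian process with mean $\mu$ and covariance $\sigma^2$ truncated to $\mathcal G$, subject to the following for all $g\in\mathcal G$: $x_0^g=x_0$, $x_{i+1}^g=f(x_i^g,u_i)+B_d\,g(x_i^g,u_i)$,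 $(x_i^g,u_i)\in\mathcal Z$ for $0\le i\le H-1$, and $x_H^g\in\mathcal Z_{\mathrm f}$. Theorem. With probability at least $1-p$ over the data, the following holds. Whenever $\mathcal Z_{\mathrm f}$ is robust positively invariant with a fixed input $u_{\mathrm f}$, i.e. $(x,u_{\mathrm f})\in\mathcal Z$ and $f(x,u_{\mathrm f})+B_d\,g(x,u_{\mathrm f})\in\mathcal Z_{\mathrm f}$ for all $g\in\mathcal G$ and $x\in\mathcal Z_{\mathrm f}$, and the robust problem is feasible at $x_0$ with optimal sequence $u^\star=(u_0^\star,\dots,u_{H-1}^\star)$, then applying $u(k)=u_k^\star$ for $0\le k\le H-1$ and $u(k)=u_{\mathrm f}$ for $k\ge H$ to the true system started at $x(0)=x_0$ gives $(x(k),u(k))\in\mathcal Z$ for all $k\in\mathbb N$. -/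

import Mathlib

open MeasureTheory ProbabilityTheory Matrix

/-! ### Gaussian process regression -/

/-- The regularized Gram matrix `k(Z, Z) + lam² I`. -/
noncomputable def regGram {𝒳 : Type*} (k : 𝒳 → 𝒳 → ℝ) (lam : ℝ) {D : ℕ} (Z : Fin D → 𝒳) :
    Matrix (Fin D) (Fin D) ℝ :=
  Matrix.of (fun i j => k (Z i) (Z j)) + lam ^ 2 • (1 : Matrix (Fin D) (Fin D) ℝ)

/-- Posterior mean `μ(z) = k(z, Z) (k(Z, Z) + lam² I)⁻¹ Y`. -/
noncomputable def postMean {𝒳 : Type*} (k : 𝒳 → 𝒳 → ℝ) (lam : ℝ) {D : ℕ} (Z : Fin D → 𝒳)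
    (Y : Fin D → ℝ) (z : 𝒳) : ℝ :=
  (fun i => k z (Z i)) ⬝ᵥ ((regGram k lam Z)⁻¹ *ᵥ Y)

/-- Posterior covariance
`σ²(z, z') = k(z, z') - k(z, Z) (k(Z, Z) + lam² I)⁻¹ k(Z, z')`. -/
noncomputable def postCov {𝒳 : Type*} (k : 𝒳 → 𝒳 → ℝ) (lam : ℝ) {D : ℕ} (Z : Fin D → 𝒳)
    (z z' : 𝒳) : ℝ :=
  k z z' - (fun i => k z (Z i)) ⬝ᵥ ((regGram k lam Z)⁻¹ *ᵥ (fun i => k (Z i) z'))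

/-- Posterior standard deviation `σ(z) = √σ²(z, z)`. -/
noncomputable def postStd {𝒳 : Type*} (k : 𝒳 → 𝒳 → ℝ) (lam : ℝ) {D : ℕ} (Z : Fin D → 𝒳)
    (z : 𝒳) : ℝ :=
  √(postCov k lam Z z z)

/-- Information gain `I(y_A; f_A) = ½ log det (I + lam⁻² k(A, A))` between the values at `A` of a
centred Gaussian process with covariance `k` and their observations with noise variance `lam²`. -/
noncomputable def infoGain {𝒳 : Type*} (k : 𝒳 → 𝒳 → ℝ) (lam : ℝ) {D : ℕ} (A : Fin D → 𝒳) : ℝ :=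
  (1 / 2) * Real.log
    ((1 : Matrix (Fin D) (Fin D) ℝ) + (lam ^ 2)⁻¹ • Matrix.of (fun i j => k (A i) (A j))).det

/-- The information gains of all families of `D` sampling locations in `S`. -/
def infoGains {𝒳 : Type*} (k : 𝒳 → 𝒳 → ℝ) (lam : ℝ) (S : Set 𝒳) (D : ℕ) : Set ℝ :=
  {I | ∃ A : Fin D → 𝒳, (∀ i, A i ∈ S) ∧ I = infoGain k lam A}

/-- Maximum information gain `γ_D` over the sampling domain `S`
(meaningful when `infoGains k lam S D` is bounded above). -/
noncomputable def maxInfoGain {𝒳 : Type*} (k : 𝒳 → 𝒳 → ℝ) (lam : ℝ) (S : Set 𝒳) (D : ℕ) : ℝ :=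
  sSup (infoGains k lam S D)

/-- The confidence set of all functions `g` with
`μ(z) - √β σ(z) ≤ g(z) ≤ μ(z) + √β σ(z)` for all `z` in the constraint set `𝒵`. -/
def confSet {𝒳 : Type*} (k : 𝒳 → 𝒳 → ℝ) (lam β : ℝ) {D : ℕ} (Z : Fin D → 𝒳) (Y : Fin D → ℝ)
    (𝒵 : Set 𝒳) : Set (𝒳 → ℝ) :=
  {g | ∀ z ∈ 𝒵, postMean k lam Z Y z - √β * postStd k lam Z z ≤ g z ∧
    g z ≤ postMean k lam Z Y z + √β * postStd k lam Z z}

/-- `ν` is the law on path space of a Gaussian process with mean function `m` and covariance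
function `C`. -/
structure IsGPLaw {𝒳 : Type*} (m : 𝒳 → ℝ) (C : 𝒳 → 𝒳 → ℝ) (ν : Measure (𝒳 → ℝ)) : Prop where
  gaussian : IsGaussianProcess (fun (z : 𝒳) (g : 𝒳 → ℝ) => g z) ν
  mean : ∀ z, ∫ g, g z ∂ν = m z
  cov : ∀ z z', covariance (fun g : 𝒳 → ℝ => g z) (fun g => g z') ν = C z z'

/-! ### The controlled system -/

/-- One step `f(x, u) + B_d g(x, u)` of the dynamics with residual `g`. -/
def stepDyn {nx nu : ℕ} (f : (Fin nx → ℝ) × (Fin nu → ℝ) → Fin nx → ℝ) (Bd : Fin nx → ℝ)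
    (g : (Fin nx → ℝ) × (Fin nu → ℝ) → ℝ) (x : Fin nx → ℝ) (u : Fin nu → ℝ) : Fin nx → ℝ :=
  f (x, u) + g (x, u) • Bd

/-- The Moore-Penrose pseudo-inverse `Bᵀ / (Bᵀ B)` of a nonzero column `B`, applied to `v`. -/
noncomputable def pinvCol {nx : ℕ} (B v : Fin nx → ℝ) : ℝ := (B ⬝ᵥ v) / (B ⬝ᵥ B)

/-- The noisy measurement `B_d† (x⁺ - f(x, u)) + e` of the one-step prediction error at
`z = (x, u)`, where `x⁺` is the successor state of the system with residual `g`. -/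
noncomputable def measurement {nx nu : ℕ} (f : (Fin nx → ℝ) × (Fin nu → ℝ) → Fin nx → ℝ)
    (Bd : Fin nx → ℝ) (g : (Fin nx → ℝ) × (Fin nu → ℝ) → ℝ) (z : (Fin nx → ℝ) × (Fin nu → ℝ))
    (e : ℝ) : ℝ :=
  pinvCol Bd (stepDyn f Bd g z.1 z.2 - f z) + e

/-- The sublevel set `{y | h y ≤ 0}` of a vector of constraint functions. -/
def sublevel {𝒴 : Type*} {n : ℕ} (h : 𝒴 → Fin n → ℝ) : Set 𝒴 := {y | h y ≤ 0}

/-- The predicted states `x_0, …, x_H` from `x₀` under the inputs `u_0, …, u_{H-1}` and the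
residual `g`. -/
def predState {nx nu H : ℕ} (f : (Fin nx → ℝ) × (Fin nu → ℝ) → Fin nx → ℝ) (Bd : Fin nx → ℝ)
    (g : (Fin nx → ℝ) × (Fin nu → ℝ) → ℝ) (x₀ : Fin nx → ℝ) (u : Fin H → Fin nu → ℝ) :
    Fin (H + 1) → Fin nx → ℝ :=
  Fin.induction x₀ (fun i x => stepDyn f Bd g x (u i))

/-- `𝒵f` is robustly positively invariant with the input `uf` for all residuals in `𝒢`, and
admissible with respect to `𝒵`. -/
def IsRobustInvariant {nx nu : ℕ} (f : (Fin nx → ℝ) × (Fin nu → ℝ) → Fin nx → ℝ)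
    (Bd : Fin nx → ℝ) (𝒢 : Set ((Fin nx → ℝ) × (Fin nu → ℝ) → ℝ))
    (𝒵 : Set ((Fin nx → ℝ) × (Fin nu → ℝ))) (𝒵f : Set (Fin nx → ℝ)) (uf : Fin nu → ℝ) : Prop :=
  ∀ g ∈ 𝒢, ∀ x ∈ 𝒵f, (x, uf) ∈ 𝒵 ∧ stepDyn f Bd g x uf ∈ 𝒵f

/-- Feasible input sequences of the robust optimal control problem at `x₀`: for every residual in
`𝒢` the predicted trajectory satisfies the stage constraints and the terminal constraint. -/
def IsFeasible {nx nu H : ℕ} (f : (Fin nx → ℝ) × (Fin nu → ℝ) → Fin nx → ℝ) (Bd : Fin nx → ℝ)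
    (𝒢 : Set ((Fin nx → ℝ) × (Fin nu → ℝ) → ℝ)) (𝒵 : Set ((Fin nx → ℝ) × (Fin nu → ℝ)))
    (𝒵f : Set (Fin nx → ℝ)) (x₀ : Fin nx → ℝ) (u : Fin H → Fin nu → ℝ) : Prop :=
  ∀ g ∈ 𝒢, (∀ i : Fin H, (predState f Bd g x₀ u i.castSucc, u i) ∈ 𝒵) ∧
    predState f Bd g x₀ u (Fin.last H) ∈ 𝒵f

/-- The expected cost `𝔼 [∑_{i < H} l_i(x_i^g, u_i)]` for `g` distributed as the process law `ν`
truncated to (conditioned on) `𝒢`. -/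
noncomputable def expectedCost {nx nu H : ℕ} (f : (Fin nx → ℝ) × (Fin nu → ℝ) → Fin nx → ℝ)
    (Bd : Fin nx → ℝ) (𝒢 : Set ((Fin nx → ℝ) × (Fin nu → ℝ) → ℝ))
    (ν : Measure ((Fin nx → ℝ) × (Fin nu → ℝ) → ℝ))
    (l : Fin H → (Fin nx → ℝ) × (Fin nu → ℝ) → ℝ) (x₀ : Fin nx → ℝ) (u : Fin H → Fin nu → ℝ) : ℝ :=
  ∫ g, ∑ i : Fin H, l i (predState f Bd g x₀ u i.castSucc, u i) ∂(cond ν 𝒢)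

/-- Optimal input sequences of the robust optimal control problem at `x₀`. -/
def IsOptimal {nx nu H : ℕ} (f : (Fin nx → ℝ) × (Fin nu → ℝ) → Fin nx → ℝ) (Bd : Fin nx → ℝ)
    (𝒢 : Set ((Fin nx → ℝ) × (Fin nu → ℝ) → ℝ)) (𝒵 : Set ((Fin nx → ℝ) × (Fin nu → ℝ)))
    (𝒵f : Set (Fin nx → ℝ)) (ν : Measure ((Fin nx → ℝ) × (Fin nu → ℝ) → ℝ))
    (l : Fin H → (Fin nx → ℝ) × (Fin nu → ℝ) → ℝ) (x₀ : Fin nx → ℝ) (u : Fin H → Fin nu → ℝ) :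
    Prop :=
  IsFeasible f Bd 𝒢 𝒵 𝒵f x₀ u ∧ ∀ v : Fin H → Fin nu → ℝ, IsFeasible f Bd 𝒢 𝒵 𝒵f x₀ v →
    expectedCost f Bd 𝒢 ν l x₀ u ≤ expectedCost f Bd 𝒢 ν l x₀ v

/-- The applied input: `u_k` for `k ≤ H - 1`, and `uf` for `k ≥ H`. -/
def appliedInput {nu H : ℕ} (u : Fin H → Fin nu → ℝ) (uf : Fin nu → ℝ) (k : ℕ) : Fin nu → ℝ :=
  if hk : k < H then u ⟨k, hk⟩ else uf

/-! Chance enters only through one event, on which the true residual lies in the confidence set.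
There the closed-loop claim is deterministic: robust feasibility covers the true trajectory up to
time `H`, and invariance covers it afterwards (`IsFeasible.closedLoop`).

The error g(z) - μ(z) splits into an interpolation part, at most ‖g‖σ(z), and a noise part.
Cauchy-Schwarz in the product of the RKHS with ℝ^D bounds the noise part by √Q σ(z), where Q =
eᵀ(λ⁻²I - K̃⁻¹)e is `noiseQuadForm` (`abs_sub_postMean_le`). So a single number Q, independent of z,
controls all z at once.

To bound Q, compare the densities of N(0, K̃) and N(0, λ²I) at the noise vector. The logarithm of
this `likelihoodRatio` is Q/2 minus the information gain. Although K̃ is random, the ratio has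
expectation one: bordering K̃ by one row factors it into one-step ratios of Gaussian densities
(`likelihoodRatio_succ`). The parameters of each ratio are known before the next noise is drawn, so
the ratio has conditional mean one (`lintegral_likelihoodRatio`). Markov's inequality then gives Q ≤
2(γ_D + log(1/p)) with probability at least 1 - p. -/

/-! ### Bordered symmetric matrices -/

section Bordered

variable {n : ℕ} (M : Matrix (Fin (n + 1)) (Fin (n + 1)) ℝ)

/-- Determinant of a bordered matrix as the determinant of the leading block times the Schur
complement. -/
theorem det_bordered (hA : IsUnit (M.submatrix Fin.castSucc Fin.castSucc).det)
    (hM : ∀ i j, M i j = M j i) :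
    M.det = (M.submatrix Fin.castSucc Fin.castSucc).det *
      (M (Fin.last n) (Fin.last n) - (fun i => M i.castSucc (Fin.last n)) ⬝ᵥ
        ((M.submatrix Fin.castSucc Fin.castSucc)⁻¹ *ᵥ fun i => M i.castSucc (Fin.last n))) := by
  set A := M.submatrix Fin.castSucc Fin.castSucc with hAdef
  let _ := A.invertibleOfIsUnitDet hA
  have hb : M.submatrix (finSumFinEquiv : Fin n ⊕ Fin 1 ≃ Fin (n + 1)) finSumFinEquiv =
      fromBlocks A (Matrix.of fun i _ => M i.castSucc (Fin.last n))
        (Matrix.of fun _ i => M i.castSucc (Fin.last n))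
        (Matrix.of fun _ _ => M (Fin.last n) (Fin.last n)) := by
    ext i j
    rcases i with i | i <;> rcases j with j | j
    · rfl
    · have : j = 0 := Subsingleton.elim _ _
      subst this; rfl
    · have : i = 0 := Subsingleton.elim _ _
      subst this; exact hM _ _
    · have : i = 0 := Subsingleton.elim _ _
      have : j = 0 := Subsingleton.elim _ _
      subst i; subst j; rfl
  rw [← det_submatrix_equiv_self (finSumFinEquiv : Fin n ⊕ Fin 1 ≃ Fin (n + 1)) M, hb,
    det_fromBlocks₁₁, det_fin_one, invOf_eq_nonsing_inv, Matrix.mul_assoc]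
  rfl

/-- The inverse quadratic form of a bordered matrix, by completing the square in the last
variable. -/
theorem inv_quadForm_bordered (hA : IsUnit (M.submatrix Fin.castSucc Fin.castSucc).det)
    (hM : ∀ i j, M i j = M j i) (hdet : IsUnit M.det) (e : Fin (n + 1) → ℝ) (s : ℝ)
    (hs : s = M (Fin.last n) (Fin.last n) - (fun i => M i.castSucc (Fin.last n)) ⬝ᵥ
        ((M.submatrix Fin.castSucc Fin.castSucc)⁻¹ *ᵥ fun i => M i.castSucc (Fin.last n)))
    (hs0 : s ≠ 0) :
    e ⬝ᵥ (M⁻¹ *ᵥ e) = (fun i : Fin n => e i.castSucc) ⬝ᵥ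
        ((M.submatrix Fin.castSucc Fin.castSucc)⁻¹ *ᵥ fun i => e i.castSucc) +
      (e (Fin.last n) - (fun i => M i.castSucc (Fin.last n)) ⬝ᵥ
        ((M.submatrix Fin.castSucc Fin.castSucc)⁻¹ *ᵥ fun i => e i.castSucc)) ^ 2 / s := by
  set A := M.submatrix Fin.castSucc Fin.castSucc with hAdef
  set b : Fin n → ℝ := fun i => M i.castSucc (Fin.last n) with hb
  set e0 : Fin n → ℝ := fun i => e i.castSucc with he0
  set m := b ⬝ᵥ (A⁻¹ *ᵥ e0) with hm
  -- Block elimination for M w = e: eliminating the first n unknowns leaves the scalar equation s c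
  -- = e_last - m for the last one.
  set c := (e (Fin.last n) - m) / s with hc
  have hcs : c * s = e (Fin.last n) - m := by rw [hc]; field_simp
  set w0 : Fin n → ℝ := A⁻¹ *ᵥ e0 - c • (A⁻¹ *ᵥ b) with hw0
  set w : Fin (n + 1) → ℝ := Fin.snoc w0 c with hw
  have hsymm : b ⬝ᵥ (A⁻¹ *ᵥ e0) = e0 ⬝ᵥ (A⁻¹ *ᵥ b) := by
    have hAt : Aᵀ = A := by ext i j; exact hM _ _
    rw [dotProduct_mulVec, ← mulVec_transpose, transpose_nonsing_inv, hAt, dotProduct_comm]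
  have hAw : A *ᵥ w0 = e0 - c • b := by
    rw [hw0, mulVec_sub, mulVec_smul, mulVec_mulVec, mulVec_mulVec, mul_nonsing_inv _ hA,
      one_mulVec, one_mulVec]
  have hMw : M *ᵥ w = e := by
    ext i
    induction i using Fin.lastCases with
    | last =>
      have h1 : ∑ i : Fin n, M (Fin.last n) i.castSucc * w0 i = b ⬝ᵥ w0 :=
        Finset.sum_congr rfl fun i _ => by rw [hM]
      simp only [mulVec, dotProduct, Fin.sum_univ_castSucc, hw, Fin.snoc_castSucc, Fin.snoc_last]
      rw [h1, hw0, dotProduct_sub, dotProduct_smul, smul_eq_mul]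
      have : c * s = c * (M (Fin.last n) (Fin.last n) - b ⬝ᵥ (A⁻¹ *ᵥ b)) := by rw [← hs]
      linarith
    | cast i =>
      have h1 := congrFun hAw i
      simp only [mulVec, dotProduct, Fin.sum_univ_castSucc, hw, Fin.snoc_castSucc,
        Fin.snoc_last] at h1 ⊢
      simp only [hAdef, submatrix_apply] at h1
      rw [h1]
      simp only [he0, hb, Pi.sub_apply, Pi.smul_apply, smul_eq_mul]
      ring
  have hinv : M⁻¹ *ᵥ e = w := by
    rw [← hMw, mulVec_mulVec, nonsing_inv_mul _ hdet, one_mulVec]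
  have h2 : e ⬝ᵥ w = e0 ⬝ᵥ w0 + e (Fin.last n) * c := by
    simp only [dotProduct, Fin.sum_univ_castSucc, hw, Fin.snoc_castSucc, Fin.snoc_last, he0]
  rw [hinv, h2, hw0, dotProduct_sub, dotProduct_smul, ← hsymm, smul_eq_mul, ← hm, hc]
  field_simp
  ring

end Bordered

/-! ### Regularized Gram matrices -/

section Gram

variable {𝒳 : Type*} {k : 𝒳 → 𝒳 → ℝ} {lam : ℝ}

theorem regGram_apply {D : ℕ} (Z : Fin D → 𝒳) (i j : Fin D) :
    regGram k lam Z i j = k (Z i) (Z j) + lam ^ 2 * (1 : Matrix (Fin D) (Fin D) ℝ) i j := rfl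

theorem regGram_posDef (hk : ∀ (n : ℕ) (Z : Fin n → 𝒳),
    (Matrix.of fun i j => k (Z i) (Z j)).PosSemidef) (hlam : 0 < lam) {D : ℕ} (Z : Fin D → 𝒳) :
    (regGram k lam Z).PosDef :=
  PosDef.posSemidef_add (hk D Z) (PosDef.one.smul (by positivity))

theorem regGram_symm (hsymm : ∀ z z', k z z' = k z' z) {D : ℕ} (Z : Fin D → 𝒳) (i j : Fin D) :
    regGram k lam Z i j = regGram k lam Z j i := by
  rw [regGram_apply, regGram_apply, hsymm, one_apply, one_apply]
  simp only [eq_comm]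

theorem regGram_submatrix_castSucc {n : ℕ} (Z : Fin (n + 1) → 𝒳) :
    (regGram k lam Z).submatrix Fin.castSucc Fin.castSucc =
      regGram k lam (fun i : Fin n => Z i.castSucc) := by
  ext i j
  simp [regGram_apply, one_apply]

theorem regGram_castSucc_last {n : ℕ} (Z : Fin (n + 1) → 𝒳) :
    (fun i : Fin n => regGram k lam Z i.castSucc (Fin.last n)) =
      fun i => k (Z i.castSucc) (Z (Fin.last n)) := by
  ext i
  simp [regGram_apply, one_apply, (Fin.castSucc_lt_last i).ne]

/-- In Gaussian terms, a Schur complement is a conditional variance: here that of the last noisy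
observation given the earlier ones, which is posterior variance plus noise variance. -/
theorem schur_regGram (hsymm : ∀ z z', k z z' = k z' z) {n : ℕ} (Z : Fin (n + 1) → 𝒳) :
    regGram k lam Z (Fin.last n) (Fin.last n) -
      (fun i : Fin n => regGram k lam Z i.castSucc (Fin.last n)) ⬝ᵥ
        (((regGram k lam Z).submatrix Fin.castSucc Fin.castSucc)⁻¹ *ᵥ
          fun i => regGram k lam Z i.castSucc (Fin.last n)) =
    lam ^ 2 + postCov k lam (fun i : Fin n => Z i.castSucc) (Z (Fin.last n)) (Z (Fin.last n)) := by
  rw [regGram_submatrix_castSucc, regGram_castSucc_last, regGram_apply, one_apply_eq, postCov]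
  simp only [hsymm (Z (Fin.last n)) (Z (Fin.castSucc _))]
  ring

variable (hk : ∀ (n : ℕ) (Z : Fin n → 𝒳), (Matrix.of fun i j => k (Z i) (Z j)).PosSemidef)
  (hsymm : ∀ z z', k z z' = k z' z) (hlam : 0 < lam)

include hk hsymm hlam

theorem det_regGram_succ {n : ℕ} (Z : Fin (n + 1) → 𝒳) :
    (regGram k lam Z).det = (regGram k lam (fun i : Fin n => Z i.castSucc)).det *
      (lam ^ 2 +
        postCov k lam (fun i : Fin n => Z i.castSucc) (Z (Fin.last n)) (Z (Fin.last n))) := by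
  rw [det_bordered (regGram k lam Z) _ (regGram_symm hsymm Z), schur_regGram hsymm,
    regGram_submatrix_castSucc]
  rw [regGram_submatrix_castSucc]
  exact (regGram_posDef hk hlam _).det_pos.ne'.isUnit

/-- A quotient of two positive determinants; nonnegativity of the posterior variance itself is not
needed. -/
theorem predVar_pos {n : ℕ} (Z : Fin (n + 1) → 𝒳) :
    0 < lam ^ 2 +
      postCov k lam (fun i : Fin n => Z i.castSucc) (Z (Fin.last n)) (Z (Fin.last n)) := by
  have h := (regGram_posDef hk hlam Z).det_pos
  rw [det_regGram_succ hk hsymm hlam] at h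
  exact pos_of_mul_pos_right h (regGram_posDef hk hlam _).det_pos.le

/-- The chain rule for the exponent of a Gaussian density: the new term is the squared error of
predicting the last entry of `e` from the others, over the predictive variance. -/
theorem inv_quadForm_regGram_succ {n : ℕ} (Z : Fin (n + 1) → 𝒳) (e : Fin (n + 1) → ℝ) :
    e ⬝ᵥ ((regGram k lam Z)⁻¹ *ᵥ e) =
      (fun i : Fin n => e i.castSucc) ⬝ᵥ
        ((regGram k lam (fun i : Fin n => Z i.castSucc))⁻¹ *ᵥ fun i => e i.castSucc) +
      (e (Fin.last n) - postMean k lam (fun i : Fin n => Z i.castSucc)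
        (fun i => e i.castSucc) (Z (Fin.last n))) ^ 2 /
      (lam ^ 2 +
        postCov k lam (fun i : Fin n => Z i.castSucc) (Z (Fin.last n)) (Z (Fin.last n))) := by
  rw [inv_quadForm_bordered (regGram k lam Z) _ (regGram_symm hsymm Z)
    (regGram_posDef hk hlam Z).det_pos.ne'.isUnit e _ (schur_regGram hsymm Z).symm
    (predVar_pos hk hsymm hlam Z).ne', regGram_submatrix_castSucc, regGram_castSucc_last, postMean]
  · simp only [hsymm (Z (Fin.last n)) (Z (Fin.castSucc _))]
  · rw [regGram_submatrix_castSucc]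
    exact (regGram_posDef hk hlam _).det_pos.ne'.isUnit

end Gram

/-! ### Measurability of the posterior -/

section Measurability

variable {Ω : Type*} {m : MeasurableSpace Ω}

theorem measurable_matrix_det {n : ℕ} {M : Ω → Matrix (Fin n) (Fin n) ℝ}
    (hM : ∀ i j, Measurable fun ω => M ω i j) : Measurable fun ω => (M ω).det := by
  simp only [det_apply]
  exact Finset.measurable_sum _ fun σ _ =>
    (Finset.measurable_prod _ fun i _ => hM _ _).const_smul _

/-- The formula `det⁻¹ • adjugate` also holds for singular matrices, where both sides vanish, so no
invertibility is required. -/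
theorem measurable_matrix_inv {n : ℕ} {M : Ω → Matrix (Fin n) (Fin n) ℝ}
    (hM : ∀ i j, Measurable fun ω => M ω i j) (i j : Fin n) :
    Measurable fun ω => (M ω)⁻¹ i j := by
  simp only [inv_def, Ring.inverse_eq_inv', Matrix.smul_apply, smul_eq_mul, adjugate_apply]
  refine (measurable_matrix_det hM).inv.mul (measurable_matrix_det fun a b => ?_)
  simp only [updateRow_apply]
  split_ifs
  · exact measurable_const
  · exact hM _ _

theorem measurable_dotProduct_inv_mulVec {n : ℕ} {M : Ω → Matrix (Fin n) (Fin n) ℝ}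
    (hM : ∀ i j, Measurable fun ω => M ω i j) {v w : Ω → Fin n → ℝ}
    (hv : ∀ i, Measurable fun ω => v ω i) (hw : ∀ i, Measurable fun ω => w ω i) :
    Measurable fun ω => v ω ⬝ᵥ ((M ω)⁻¹ *ᵥ w ω) := by
  simp only [dotProduct, mulVec]
  exact Finset.measurable_sum _ fun i _ => (hv i).mul
    (Finset.measurable_sum _ fun j _ => (measurable_matrix_inv hM i j).mul (hw j))

variable {𝒳 : Type*} [MeasurableSpace 𝒳] {k : 𝒳 → 𝒳 → ℝ} (hk : Measurable (Function.uncurry k))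
  {lam : ℝ} {D : ℕ} {Z : Fin D → Ω → 𝒳} (hZ : ∀ i, Measurable (Z i))

include hk in
theorem Measurable.kernel_comp {f g : Ω → 𝒳} (hf : Measurable f) (hg : Measurable g) :
    Measurable fun ω => k (f ω) (g ω) :=
  hk.comp (hf.prodMk hg)

include hk hZ

theorem measurable_regGram (i j : Fin D) :
    Measurable fun ω => regGram k lam (fun i => Z i ω) i j := by
  simp only [regGram_apply]
  exact (Measurable.kernel_comp hk (hZ i) (hZ j)).add_const _

theorem measurable_postMean {e : Ω → Fin D → ℝ} (he : ∀ i, Measurable fun ω => e ω i)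
    {z : Ω → 𝒳} (hz : Measurable z) :
    Measurable fun ω => postMean k lam (fun i => Z i ω) (e ω) (z ω) :=
  measurable_dotProduct_inv_mulVec (measurable_regGram hk hZ)
    (fun i => Measurable.kernel_comp hk hz (hZ i)) he

theorem measurable_postCov {z : Ω → 𝒳} (hz : Measurable z) :
    Measurable fun ω => postCov k lam (fun i => Z i ω) (z ω) (z ω) :=
  (Measurable.kernel_comp hk hz hz).sub
    (measurable_dotProduct_inv_mulVec (measurable_regGram hk hZ)
      (fun i => Measurable.kernel_comp hk hz (hZ i))
      (fun i => Measurable.kernel_comp hk (hZ i) hz))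

end Measurability

/-! ### The self-normalized noise process -/

section SelfNormalized

variable {𝒳 : Type*}

/-- The quadratic form `eᵀ (lam⁻² I - (k(Z, Z) + lam² I)⁻¹) e`. -/
noncomputable def noiseQuadForm (k : 𝒳 → 𝒳 → ℝ) (lam : ℝ) {D : ℕ} (Z : Fin D → 𝒳)
    (e : Fin D → ℝ) : ℝ :=
  (e ⬝ᵥ e) / lam ^ 2 - e ⬝ᵥ ((regGram k lam Z)⁻¹ *ᵥ e)

/-- The ratio at `e` of the centred Gaussian densities with covariances `k(Z, Z) + lam² I` and
`lam² I`. -/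
noncomputable def likelihoodRatio (k : 𝒳 → 𝒳 → ℝ) (lam : ℝ) {D : ℕ} (Z : Fin D → 𝒳)
    (e : Fin D → ℝ) : ℝ :=
  lam ^ D / √(regGram k lam Z).det * Real.exp (noiseQuadForm k lam Z e / 2)

variable {k : 𝒳 → 𝒳 → ℝ} {lam : ℝ}

theorem likelihoodRatio_nonneg (hlam : 0 < lam) {D : ℕ} (Z : Fin D → 𝒳) (e : Fin D → ℝ) :
    0 ≤ likelihoodRatio k lam Z e := by
  unfold likelihoodRatio; positivity

theorem measurable_likelihoodRatio [MeasurableSpace 𝒳] {Ω : Type*} {m : MeasurableSpace Ω}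
    (hk : Measurable (Function.uncurry k)) {D : ℕ} {Z : Fin D → Ω → 𝒳}
    (hZ : ∀ i, Measurable (Z i)) {e : Fin D → Ω → ℝ} (he : ∀ i, Measurable (e i)) :
    Measurable fun ω => likelihoodRatio k lam (fun i => Z i ω) (fun i => e i ω) := by
  unfold likelihoodRatio noiseQuadForm
  refine ((measurable_matrix_det (measurable_regGram hk hZ)).sqrt.const_div _).mul
    (Real.measurable_exp.comp (Measurable.div_const (Measurable.sub ?_ ?_) _))
  · simp only [dotProduct]
    exact Measurable.div_const (Finset.measurable_sum _ fun i _ => (he i).mul (he i)) _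
  · exact measurable_dotProduct_inv_mulVec (measurable_regGram hk hZ) he he

/-- The determinant and the quadratic form both split along the border, so the new factor is the
predictive density of the last entry divided by its density under pure noise. -/
theorem likelihoodRatio_succ
    (hk : ∀ (n : ℕ) (Z : Fin n → 𝒳), (Matrix.of fun i j => k (Z i) (Z j)).PosSemidef)
    (hsymm : ∀ z z', k z z' = k z' z) (hlam : 0 < lam) {n : ℕ} (Z : Fin (n + 1) → 𝒳)
    (e : Fin (n + 1) → ℝ) :
    likelihoodRatio k lam Z e =
      likelihoodRatio k lam (fun i : Fin n => Z i.castSucc) (fun i => e i.castSucc) *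
      (gaussianPDFReal
          (postMean k lam (fun i : Fin n => Z i.castSucc) (fun i => e i.castSucc) (Z (Fin.last n)))
          (Real.toNNReal (lam ^ 2 + postCov k lam (fun i : Fin n => Z i.castSucc)
            (Z (Fin.last n)) (Z (Fin.last n)))) (e (Fin.last n)) /
        gaussianPDFReal 0 (Real.toNNReal (lam ^ 2)) (e (Fin.last n))) := by
  have hs := predVar_pos hk hsymm hlam Z
  have hd := (regGram_posDef hk hlam (fun i : Fin n => Z i.castSucc)).det_pos
  have hee : e ⬝ᵥ e = (fun i : Fin n => e i.castSucc) ⬝ᵥ (fun i : Fin n => e i.castSucc) +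
      e (Fin.last n) ^ 2 := by
    simp only [dotProduct, Fin.sum_univ_castSucc, sq]
  rw [likelihoodRatio, likelihoodRatio, noiseQuadForm, noiseQuadForm,
    det_regGram_succ hk hsymm hlam, inv_quadForm_regGram_succ hk hsymm hlam, gaussianPDFReal,
    gaussianPDFReal, Real.coe_toNNReal _ hs.le, Real.coe_toNNReal _ (by positivity), hee]
  generalize lam ^ 2 + postCov k lam (fun i : Fin n => Z i.castSucc)
    (Z (Fin.last n)) (Z (Fin.last n)) = s at *
  generalize postMean k lam (fun i : Fin n => Z i.castSucc) (fun i => e i.castSucc)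
    (Z (Fin.last n)) = μ
  generalize (regGram k lam (fun i : Fin n => Z i.castSucc)).det = d at *
  generalize (fun i : Fin n => e i.castSucc) ⬝ᵥ
    ((regGram k lam (fun i : Fin n => Z i.castSucc))⁻¹ *ᵥ fun i => e i.castSucc) = q
  generalize (fun i : Fin n => e i.castSucc) ⬝ᵥ (fun i : Fin n => e i.castSucc) = r
  generalize e (Fin.last n) = t
  have hexp : Real.exp (((r + t ^ 2) / lam ^ 2 - (q + (t - μ) ^ 2 / s)) / 2) =
      Real.exp ((r / lam ^ 2 - q) / 2) *
        (Real.exp (-(t - μ) ^ 2 / (2 * s)) / Real.exp (-(t - 0) ^ 2 / (2 * lam ^ 2))) := by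
    rw [← Real.exp_sub, ← Real.exp_add]
    congr 1
    field_simp
    ring
  have h2π : 0 < √(2 * Real.pi) := by positivity
  have hsd : 0 < √d := Real.sqrt_pos.2 hd
  have hss : 0 < √s := Real.sqrt_pos.2 hs
  rw [hexp, Real.sqrt_mul hd.le, Real.sqrt_mul (by positivity) s,
    Real.sqrt_mul (by positivity) (lam ^ 2), Real.sqrt_sq hlam.le]
  have := Real.exp_pos (-(t - 0) ^ 2 / (2 * lam ^ 2))
  field_simp
  ring

/-- The denominator cancels the density of the base measure. As `μ` and `s` are arbitrary, they may
later depend on the past. -/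
theorem lintegral_gaussianPDFReal_div {μ : ℝ} {s v : NNReal} (hs : s ≠ 0) (hv : v ≠ 0) :
    ∫⁻ t, ENNReal.ofReal (gaussianPDFReal μ s t / gaussianPDFReal 0 v t) ∂(gaussianReal 0 v) =
      1 := by
  rw [gaussianReal_of_var_ne_zero _ hv, lintegral_withDensity_eq_lintegral_mul _
    (measurable_gaussianPDF _ _) (by fun_prop), ← lintegral_gaussianPDFReal_eq_one μ hs]
  refine lintegral_congr fun t => ?_
  have h := gaussianPDFReal_pos 0 v t hv
  rw [Pi.mul_apply, gaussianPDF, ← ENNReal.ofReal_mul h.le, mul_div_cancel₀ _ h.ne']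

/-- The likelihood ratio along adaptively chosen locations has expectation one. -/
theorem lintegral_likelihoodRatio [MeasurableSpace 𝒳]
    (hkm : Measurable (Function.uncurry k))
    (hk : ∀ (n : ℕ) (Z : Fin n → 𝒳), (Matrix.of fun i j => k (Z i) (Z j)).PosSemidef)
    (hsymm : ∀ z z', k z z' = k z' z) (hlam : 0 < lam)
    {Ω : Type*} {mΩ : MeasurableSpace Ω} (P : Measure Ω) [IsProbabilityMeasure P]
    (ℱ : Filtration ℕ mΩ) {D : ℕ} (Z : Fin D → Ω → 𝒳)
    (hZ : ∀ i : Fin D, Measurable[ℱ (i : ℕ)] (Z i))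
    (ε : Fin D → Ω → ℝ) (hε : ∀ i : Fin D, Measurable[ℱ ((i : ℕ) + 1)] (ε i))
    (hεlaw : ∀ i, HasLaw (ε i) (gaussianReal 0 (Real.toNNReal (lam ^ 2))) P)
    (hεindep : ∀ i : Fin D, Indep (MeasurableSpace.comap (ε i) inferInstance) (ℱ (i : ℕ)) P) :
    ∫⁻ ω, ENNReal.ofReal (likelihoodRatio k lam (fun i => Z i ω) (fun i => ε i ω)) ∂P = 1 := by
  induction D with
  | zero => simp [likelihoodRatio, noiseQuadForm]
  | succ n ih =>
    specialize ih (fun i => Z i.castSucc) (fun i => hZ i.castSucc) (fun i => ε i.castSucc)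
      (fun i => hε i.castSucc) (fun i => hεlaw i.castSucc) (fun i => hεindep i.castSucc)
    set v := Real.toNNReal (lam ^ 2) with hv
    have hv0 : v ≠ 0 := by
      rw [hv]; exact (Real.toNNReal_pos.2 (by positivity)).ne'
    have hZn (i : Fin n) : Measurable[ℱ n] (Z i.castSucc) :=
      (hZ i.castSucc).mono (ℱ.mono i.2.le) le_rfl
    have hεn (i : Fin n) : Measurable[ℱ n] (ε i.castSucc) :=
      (hε i.castSucc).mono (ℱ.mono i.2) le_rfl
    have hzn : Measurable[ℱ n] (Z (Fin.last n)) := hZ (Fin.last n)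
    set L : Ω → ℝ := fun ω =>
      likelihoodRatio k lam (fun i : Fin n => Z i.castSucc ω) (fun i => ε i.castSucc ω) with hL
    set m : Ω → ℝ := fun ω => postMean k lam (fun i : Fin n => Z i.castSucc ω)
      (fun i => ε i.castSucc ω) (Z (Fin.last n) ω) with hm
    set s : Ω → NNReal := fun ω => Real.toNNReal (lam ^ 2 +
      postCov k lam (fun i : Fin n => Z i.castSucc ω) (Z (Fin.last n) ω) (Z (Fin.last n) ω))
      with hs
    have hs0 (ω : Ω) : s ω ≠ 0 :=
      (Real.toNNReal_pos.2 (predVar_pos hk hsymm hlam fun i => Z i ω)).ne'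
    -- `X` involves the locations up to index n but the noise only up to n - 1. Hence it is `ℱ
    -- n`-measurable and independent of the last noise variable.
    set X : Ω → ℝ × ℝ × NNReal := fun ω => (L ω, m ω, s ω) with hX
    have hXn : Measurable[ℱ n] X :=
      (measurable_likelihoodRatio hkm hZn hεn).prodMk
        ((measurable_postMean hkm hZn hεn hzn).prodMk
          ((measurable_postCov hkm hZn hzn).const_add _).real_toNNReal)
    have hXm : Measurable X := hXn.mono (ℱ.le n) le_rfl
    have hεm : Measurable (ε (Fin.last n)) := (hε (Fin.last n)).mono (ℱ.le _) le_rfl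
    have hind : IndepFun X (ε (Fin.last n)) P :=
      ((IndepFun_iff_Indep _ _ _).2
        (indep_of_indep_of_le_right (hεindep (Fin.last n)) hXn.comap_le)).symm
    have hprod : P.map (fun ω => (X ω, ε (Fin.last n) ω)) =
        (P.map X).prod (gaussianReal 0 v) := by
      rw [(indepFun_iff_map_prod_eq_prod_map_map hXm.aemeasurable hεm.aemeasurable).1 hind,
        (hεlaw (Fin.last n)).map_eq]
    set F : (ℝ × ℝ × NNReal) × ℝ → ENNReal := fun y => ENNReal.ofReal y.1.1 *
      ENNReal.ofReal (gaussianPDFReal y.1.2.1 y.1.2.2 y.2 / gaussianPDFReal 0 v y.2) with hF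
    have hFm : Measurable F := by
      refine (by fun_prop : Measurable fun y : (ℝ × ℝ × NNReal) × ℝ =>
        ENNReal.ofReal y.1.1).mul (Measurable.ennreal_ofReal (Measurable.div ?_ ?_))
      · exact measurable_uncurry_gaussianPDFReal.comp
          (by fun_prop : Measurable fun y : (ℝ × ℝ × NNReal) × ℝ => (y.1.2.1, y.1.2.2, y.2))
      · exact (measurable_gaussianPDFReal 0 v).comp measurable_snd
    calc ∫⁻ ω, ENNReal.ofReal (likelihoodRatio k lam (fun i => Z i ω) (fun i => ε i ω)) ∂P
        = ∫⁻ ω, F (X ω, ε (Fin.last n) ω) ∂P := by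
          refine lintegral_congr fun ω => ?_
          rw [likelihoodRatio_succ hk hsymm hlam,
            ENNReal.ofReal_mul (likelihoodRatio_nonneg hlam _ _)]
      _ = ∫⁻ y, F y ∂((P.map X).prod (gaussianReal 0 v)) := by
          rw [← hprod, lintegral_map hFm (hXm.prodMk hεm)]
      _ = ∫⁻ ω, ∫⁻ t, F (X ω, t) ∂(gaussianReal 0 v) ∂P := by
          rw [lintegral_prod _ hFm.aemeasurable,
            lintegral_map (hFm.lintegral_prod_right' (ν := gaussianReal 0 v)) hXm]
      -- With the past frozen, the last density ratio integrates to one.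
      _ = ∫⁻ ω, ENNReal.ofReal (L ω) ∂P := by
          refine lintegral_congr fun ω => ?_
          rw [hF, lintegral_const_mul' _ _ ENNReal.ofReal_ne_top,
            lintegral_gaussianPDFReal_div (hs0 ω) hv0, mul_one]
      _ = 1 := ih

/-- Identifies the logarithm of the prefactor λ^D / √det of `likelihoodRatio` as minus the
information gain. -/
theorem infoGain_eq (hlam : 0 < lam) {D : ℕ} (Z : Fin D → 𝒳) :
    infoGain k lam Z = (1 / 2) * Real.log ((regGram k lam Z).det / (lam ^ D) ^ 2) := by
  have h : (1 : Matrix (Fin D) (Fin D) ℝ) + (lam ^ 2)⁻¹ • Matrix.of (fun i j => k (Z i) (Z j)) =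
      (lam ^ 2)⁻¹ • regGram k lam Z := by
    rw [regGram, smul_add, smul_smul, inv_mul_cancel₀ (by positivity), one_smul, add_comm]
  rw [infoGain, h, det_smul, Fintype.card_fin]
  congr 2
  rw [inv_pow, ← pow_mul, ← pow_mul, mul_comm D 2]
  field_simp

/-- If the likelihood ratio is less than `1 / p`, then the normalized noise energy is bounded by
the information gain. -/
theorem noiseQuadForm_le
    (hk : ∀ (n : ℕ) (Z : Fin n → 𝒳), (Matrix.of fun i j => k (Z i) (Z j)).PosSemidef)
    (hlam : 0 < lam) {p : ℝ} {D : ℕ} (Z : Fin D → 𝒳) (e : Fin D → ℝ)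
    (h : likelihoodRatio k lam Z e < 1 / p) :
    noiseQuadForm k lam Z e ≤ 2 * (infoGain k lam Z + Real.log (1 / p)) := by
  have hd := (regGram_posDef hk hlam Z).det_pos
  have hsd : 0 < √(regGram k lam Z).det := Real.sqrt_pos.2 hd
  have hpos : 0 < lam ^ D / √(regGram k lam Z).det := by positivity
  have hlog := Real.log_le_log (mul_pos hpos (Real.exp_pos _)) h.le
  rw [Real.log_mul hpos.ne' (Real.exp_pos _).ne', Real.log_exp,
    Real.log_div (by positivity) hsd.ne', Real.log_sqrt hd.le] at hlog
  rw [infoGain_eq hlam, Real.log_div hd.ne' (by positivity), Real.log_pow (lam ^ D) 2]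
  push_cast
  linarith

/-- A random variable whose positive part has expectation one is less than `1 / p` with probability
at least `1 - p`. -/
theorem ofReal_one_sub_le_measure_lt_inv
    {Ω : Type*} {mΩ : MeasurableSpace Ω} (P : Measure Ω) [IsProbabilityMeasure P]
    {R : Ω → ℝ} (hR : Measurable R) (hint : ∫⁻ ω, ENNReal.ofReal (R ω) ∂P = 1)
    {p : ℝ} (hp : 0 < p) :
    ENNReal.ofReal (1 - p) ≤ P {ω | R ω < 1 / p} := by
  have hms : MeasurableSet {ω | R ω < 1 / p} := measurableSet_lt hR measurable_const
  have hmarkov : P {ω | R ω < 1 / p}ᶜ ≤ ENNReal.ofReal p := by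
    have h1 := mul_meas_ge_le_lintegral (μ := P) hR.ennreal_ofReal (ENNReal.ofReal (1 / p))
    rw [hint] at h1
    have h2 : {ω | R ω < 1 / p}ᶜ ⊆ {ω | ENNReal.ofReal (1 / p) ≤ ENNReal.ofReal (R ω)} :=
      fun ω hω => ENNReal.ofReal_le_ofReal (not_lt.1 hω)
    calc P {ω | R ω < 1 / p}ᶜ
        = ENNReal.ofReal p * (ENNReal.ofReal (1 / p) * P {ω | R ω < 1 / p}ᶜ) := by
          rw [← mul_assoc, ← ENNReal.ofReal_mul hp.le, mul_one_div_cancel hp.ne',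
            ENNReal.ofReal_one, one_mul]
      _ ≤ ENNReal.ofReal p * 1 := by gcongr; exact (mul_le_mul_right (measure_mono h2) _).trans h1
      _ = ENNReal.ofReal p := mul_one _
  rw [ENNReal.ofReal_sub _ hp.le, ENNReal.ofReal_one, tsub_le_iff_right,
    ← prob_add_prob_compl (μ := P) hms]
  gcongr

end SelfNormalized

/-! ### Confidence bounds in the reproducing kernel Hilbert space -/

section RKHSBound

open scoped InnerProductSpace

variable {𝒳 ℋ : Type*} [NormedAddCommGroup ℋ] [InnerProductSpace ℝ ℋ] [CompleteSpace ℋ]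
  [RKHS ℝ ℋ 𝒳 ℝ] {k : 𝒳 → 𝒳 → ℝ} (hkernel : ∀ z z', RKHS.kernel ℋ z z' 1 = k z z')

include hkernel

theorem inner_kerFun_one (z z' : 𝒳) :
    ⟪RKHS.kerFun ℋ z (1 : ℝ), RKHS.kerFun ℋ z' (1 : ℝ)⟫_ℝ = k z z' := by
  rw [RKHS.kerFun_inner, RKHS.kerFun_apply, hkernel]
  simp

theorem kernel_symm (z z' : 𝒳) : k z z' = k z' z := by
  rw [← inner_kerFun_one hkernel, real_inner_comm, inner_kerFun_one hkernel]

theorem inner_sum_kerFun {D : ℕ} (Z : Fin D → 𝒳) (a b : Fin D → ℝ) :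
    ⟪∑ i, a i • RKHS.kerFun ℋ (Z i) (1 : ℝ), ∑ i, b i • RKHS.kerFun ℋ (Z i) (1 : ℝ)⟫_ℝ =
      a ⬝ᵥ ((Matrix.of fun i j => k (Z i) (Z j)) *ᵥ b) := by
  simp only [sum_inner, inner_sum, inner_smul_left, inner_smul_right, inner_kerFun_one hkernel,
    dotProduct, mulVec, Matrix.of_apply, Finset.mul_sum, RCLike.conj_to_real]
  rw [Finset.sum_comm]
  exact Finset.sum_congr rfl fun i _ => Finset.sum_congr rfl fun j _ => by ring

theorem inner_kerFun_sum {D : ℕ} (Z : Fin D → 𝒳) (z : 𝒳) (b : Fin D → ℝ) :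
    ⟪RKHS.kerFun ℋ z (1 : ℝ), ∑ i, b i • RKHS.kerFun ℋ (Z i) (1 : ℝ)⟫_ℝ =
      (fun i => k z (Z i)) ⬝ᵥ b := by
  simp only [inner_sum, inner_smul_right, inner_kerFun_one hkernel, dotProduct]
  exact Finset.sum_congr rfl fun i _ => mul_comm _ _

/-- The quadratic form at a is the squared norm of ∑ aᵢ k(Zᵢ, ·). -/
theorem kernel_posSemidef (D : ℕ) (Z : Fin D → 𝒳) :
    (Matrix.of fun i j => k (Z i) (Z j)).PosSemidef := by
  refine PosSemidef.of_dotProduct_mulVec_nonneg ?_ fun a => ?_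
  · ext i j
    simp [kernel_symm hkernel (Z i) (Z j)]
  · rw [star_trivial, ← inner_sum_kerFun hkernel]
    exact real_inner_self_nonneg

/-- Deviation of a function from its posterior mean based on noisy observations. -/
theorem abs_sub_postMean_le {lam : ℝ} (hlam : 0 < lam) (g : ℋ) {D : ℕ} (Z : Fin D → 𝒳)
    (e : Fin D → ℝ) (z : 𝒳) :
    |g z - postMean k lam Z (fun i => g (Z i) + e i) z| ≤
      (‖g‖ + √(noiseQuadForm k lam Z e)) * postStd k lam Z z := by
  set K : Matrix (Fin D) (Fin D) ℝ := Matrix.of fun i j => k (Z i) (Z j) with hK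
  set G := regGram k lam Z with hG
  set kz : Fin D → ℝ := fun i => k z (Z i) with hkz
  set φ : ℋ := RKHS.kerFun ℋ z (1 : ℝ) with hφ
  -- The posterior mean at z is a · Y, and `r` represents the noiseless error g ↦ g(z) - ∑ aᵢ g(Zᵢ).
  -- The pairs (r, -λa) and (w, c) in ℋ × ℝ^D have squared norms σ²(z) and Q, and inner product a ·
  -- e; `c` is chosen for this.
  set a : Fin D → ℝ := G⁻¹ *ᵥ kz with ha
  set b : Fin D → ℝ := G⁻¹ *ᵥ e with hb
  set r : ℋ := φ - ∑ i, a i • RKHS.kerFun ℋ (Z i) (1 : ℝ) with hr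
  set w : ℋ := ∑ i, b i • RKHS.kerFun ℋ (Z i) (1 : ℝ) with hw
  set c : Fin D → ℝ := lam • b - lam⁻¹ • e with hc
  have hsymm := kernel_symm hkernel
  have hunit : IsUnit G.det :=
    (regGram_posDef (kernel_posSemidef hkernel) hlam Z).det_pos.ne'.isUnit
  have hGt : Gᵀ = G := by ext i j; exact regGram_symm hsymm Z _ _
  have hflip (v : Fin D → ℝ) : kz ⬝ᵥ (G⁻¹ *ᵥ v) = a ⬝ᵥ v := by
    rw [dotProduct_mulVec, ← mulVec_transpose, transpose_nonsing_inv, hGt]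
  have hGK (v : Fin D → ℝ) : G *ᵥ v = K *ᵥ v + lam ^ 2 • v := by
    rw [hG, regGram, add_mulVec, smul_mulVec, one_mulVec]
  have hKa : K *ᵥ a = kz - lam ^ 2 • a := by
    rw [eq_sub_iff_add_eq, ← hGK, ha, mulVec_mulVec, mul_nonsing_inv _ hunit, one_mulVec]
  have hKb : K *ᵥ b = e - lam ^ 2 • b := by
    rw [eq_sub_iff_add_eq, ← hGK, hb, mulVec_mulVec, mul_nonsing_inv _ hunit, one_mulVec]
  have hcov : postCov k lam Z z z = k z z - a ⬝ᵥ kz := by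
    rw [postCov, ← hflip kz]
    simp only [hkz, hsymm z (Z _), hG]
  have hrr : ⟪r, r⟫_ℝ = postCov k lam Z z z - lam ^ 2 * (a ⬝ᵥ a) := by
    rw [hr, inner_sub_left, inner_sub_right, inner_sub_right, inner_sum_kerFun hkernel,
      inner_kerFun_sum hkernel, real_inner_comm φ (∑ i, a i • RKHS.kerFun ℋ (Z i) (1 : ℝ)),
      inner_kerFun_sum hkernel, inner_kerFun_one hkernel, ← hK, hKa, dotProduct_sub, dotProduct_smul, hcov, dotProduct_comm a kz, smul_eq_mul]
    ring
  have haa : 0 ≤ a ⬝ᵥ a := by simpa using dotProduct_star_self_nonneg a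
  have hcov0 : 0 ≤ postCov k lam Z z z := by
    have := real_inner_self_nonneg (x := r)
    have := mul_nonneg (sq_nonneg lam) haa
    linarith
  have hσ0 : 0 ≤ postStd k lam Z z := Real.sqrt_nonneg _
  have hσ : postStd k lam Z z ^ 2 = postCov k lam Z z z := Real.sq_sqrt hcov0
  have hrσ : ‖r‖ ≤ postStd k lam Z z := by
    refine Real.le_sqrt_of_sq_le ?_
    rw [← real_inner_self_eq_norm_sq, hrr]
    have := mul_nonneg (sq_nonneg lam) haa
    linarith
  have hww : ⟪w, w⟫_ℝ + c ⬝ᵥ c = noiseQuadForm k lam Z e := by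
    rw [hw, inner_sum_kerFun hkernel, ← hK, hKb, noiseQuadForm, ← hG, ← hb, hc]
    simp only [dotProduct_sub, sub_dotProduct, dotProduct_smul, smul_dotProduct, smul_eq_mul,
      dotProduct_comm b e]
    field_simp
    ring
  have hrw : ⟪r, w⟫_ℝ + (-lam) * (a ⬝ᵥ c) = a ⬝ᵥ e := by
    rw [hr, hw, inner_sub_left, inner_sum_kerFun hkernel, inner_kerFun_sum hkernel, ← hK, hKb, hc,
      ← hkz, hb, hflip]
    simp only [dotProduct_sub, dotProduct_smul, smul_eq_mul]
    field_simp
    ring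
  have hcc : 0 ≤ c ⬝ᵥ c := by simpa using dotProduct_star_self_nonneg c
  have hQ0 : 0 ≤ noiseQuadForm k lam Z e := by
    rw [← hww]; exact add_nonneg real_inner_self_nonneg hcc
  have hac : (a ⬝ᵥ c) ^ 2 ≤ (a ⬝ᵥ a) * (c ⬝ᵥ c) := by
    simpa only [dotProduct, sq] using Finset.sum_mul_sq_le_sq_mul_sq Finset.univ a c
  -- Cauchy-Schwarz in ℋ × ℝ^D for these pairs, assembled from the inequalities in the two factors.
  have hnoise : |a ⬝ᵥ e| ≤ √(noiseQuadForm k lam Z e) * postStd k lam Z z := by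
    refine abs_le_of_sq_le_sq ?_ (by positivity)
    rw [mul_pow, Real.sq_sqrt hQ0, hσ, ← hrw, ← hww]
    have h1 : ⟪r, w⟫_ℝ ^ 2 ≤ ⟪r, r⟫_ℝ * ⟪w, w⟫_ℝ := by
      rw [sq]; exact real_inner_mul_inner_self_le r w
    have h2 : postCov k lam Z z z = ⟪r, r⟫_ℝ + lam ^ 2 * (a ⬝ᵥ a) := by rw [hrr]; ring
    have hr0 : 0 ≤ ⟪r, r⟫_ℝ := real_inner_self_nonneg
    have hw0 : 0 ≤ ⟪w, w⟫_ℝ := real_inner_self_nonneg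
    rw [h2]
    generalize ⟪r, w⟫_ℝ = x at *
    generalize ⟪r, r⟫_ℝ = rr at *
    generalize ⟪w, w⟫_ℝ = ww at *
    have h3 : (lam * (a ⬝ᵥ c)) ^ 2 ≤ (lam ^ 2 * (a ⬝ᵥ a)) * (c ⬝ᵥ c) := by
      rw [mul_pow, mul_assoc]; gcongr
    have h4 : 0 ≤ lam ^ 2 * (a ⬝ᵥ a) := by positivity
    rw [neg_mul, ← sub_eq_add_neg]
    generalize lam * (a ⬝ᵥ c) = y at *
    generalize lam ^ 2 * (a ⬝ᵥ a) = aa at *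
    generalize c ⬝ᵥ c = cc at *
    have h5 : |x| ≤ √rr * √ww := by
      rw [← Real.sqrt_mul hr0]; exact Real.abs_le_sqrt h1
    have h6 : |y| ≤ √aa * √cc := by
      rw [← Real.sqrt_mul h4]; exact Real.abs_le_sqrt h3
    have h7 : |x - y| ≤ √rr * √ww + √aa * √cc := (abs_sub _ _).trans (add_le_add h5 h6)
    calc (x - y) ^ 2 = |x - y| ^ 2 := (sq_abs _).symm
      _ ≤ (√rr * √ww + √aa * √cc) ^ 2 := by gcongr
      _ ≤ (√rr ^ 2 + √aa ^ 2) * (√ww ^ 2 + √cc ^ 2) := by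
        nlinarith [sq_nonneg (√rr * √cc - √aa * √ww)]
      _ = (ww + cc) * (rr + aa) := by
        rw [Real.sq_sqrt hr0, Real.sq_sqrt h4, Real.sq_sqrt hw0, Real.sq_sqrt hcc, mul_comm]
  have hgr : ⟪r, g⟫_ℝ = g z - a ⬝ᵥ fun i => g (Z i) := by
    rw [hr, inner_sub_left, sum_inner]
    simp [hφ, inner_smul_left, dotProduct]
  have hsplit : g z - postMean k lam Z (fun i => g (Z i) + e i) z = ⟪r, g⟫_ℝ - a ⬝ᵥ e := by
    have : (fun i => g (Z i) + e i) = (fun i => g (Z i)) + e := rfl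
    rw [postMean, ← hG, hflip, this, dotProduct_add, hgr]
    ring
  calc |g z - postMean k lam Z (fun i => g (Z i) + e i) z|
      ≤ |⟪r, g⟫_ℝ| + |a ⬝ᵥ e| := by rw [hsplit]; exact abs_sub _ _
    _ ≤ postStd k lam Z z * ‖g‖ + √(noiseQuadForm k lam Z e) * postStd k lam Z z := by
        gcongr
        exact (abs_real_inner_le_norm r g).trans (by gcongr)
    _ = _ := by ring

end RKHSBound

/-! ### Closed-loop constraint satisfaction -/

section ClosedLoop

variable {nx nu : ℕ} {f : (Fin nx → ℝ) × (Fin nu → ℝ) → Fin nx → ℝ} {Bd : Fin nx → ℝ}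

/-- The pseudo-inverse of a nonzero column is a left inverse of it. -/
theorem measurement_eq (hBd : Bd ≠ 0) (g : (Fin nx → ℝ) × (Fin nu → ℝ) → ℝ)
    (z : (Fin nx → ℝ) × (Fin nu → ℝ)) (e : ℝ) : measurement f Bd g z e = g z + e := by
  have h : Bd ⬝ᵥ Bd ≠ 0 := fun h => hBd (dotProduct_self_eq_zero.1 h)
  simp [measurement, stepDyn, pinvCol, dotProduct_smul, h]

variable {𝒢 : Set ((Fin nx → ℝ) × (Fin nu → ℝ) → ℝ)} {𝒵 : Set ((Fin nx → ℝ) × (Fin nu → ℝ))}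
  {𝒵f : Set (Fin nx → ℝ)} {uf : Fin nu → ℝ} {H : ℕ} {x₀ : Fin nx → ℝ} {u : Fin H → Fin nu → ℝ}
  {g : (Fin nx → ℝ) × (Fin nu → ℝ) → ℝ} {x : ℕ → Fin nx → ℝ}

/-- Over the horizon, the closed-loop states agree with the predictions for the true residual. -/
theorem state_eq_predState (hx0 : x 0 = x₀)
    (hx : ∀ t, x (t + 1) = stepDyn f Bd g (x t) (appliedInput u uf t)) (i : Fin (H + 1)) :
    x i = predState f Bd g x₀ u i := by
  induction i using Fin.induction with
  | zero => exact hx0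
  | succ i ih =>
    have h1 : predState f Bd g x₀ u i.succ =
        stepDyn f Bd g (predState f Bd g x₀ u i.castSucc) (u i) := rfl
    have h2 : appliedInput u uf (i : ℕ) = u i := by simp [appliedInput]
    rw [Fin.val_succ, hx, h2, h1, ← ih, Fin.val_castSucc]

/-- If the true residual lies in the set used for robust planning, then a robustly feasible input
sequence followed by the terminal input satisfies the constraints for all times. -/
theorem IsFeasible.closedLoop (hu : IsFeasible f Bd 𝒢 𝒵 𝒵f x₀ u)
    (hinv : IsRobustInvariant f Bd 𝒢 𝒵 𝒵f uf) (hg : g ∈ 𝒢) (hx0 : x 0 = x₀)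
    (hx : ∀ t, x (t + 1) = stepDyn f Bd g (x t) (appliedInput u uf t)) (t : ℕ) :
    (x t, appliedInput u uf t) ∈ 𝒵 := by
  obtain ⟨hstage, hterm⟩ := hu g hg
  have happ (t : ℕ) (ht : H ≤ t) : appliedInput u uf t = uf := by
    simp [appliedInput, ht]
  -- The terminal constraint puts x(H) in the terminal set, and `uf` is first applied at time H
  -- itself, so the induction starts there.
  have htail (t : ℕ) (ht : H ≤ t) : x t ∈ 𝒵f := by
    induction t, ht using Nat.le_induction with
    | base => rw [← state_eq_predState (uf := uf) hx0 hx] at hterm; exact hterm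
    | succ t ht ih => rw [hx, happ t ht]; exact (hinv g hg _ ih).2
  rcases lt_or_ge t H with ht | ht
  · have h1 := hstage ⟨t, ht⟩
    rw [← state_eq_predState (uf := uf) hx0 hx] at h1
    simpa [appliedInput, ht] using h1
  · rw [happ t ht]
    exact (hinv g hg _ (htail t ht)).1

end ClosedLoop

theorem theorem1
    -- dimensions, known dynamics, input direction of the residual, constraints
    {nx nu nh nf : ℕ}
    (f : (Fin nx → ℝ) × (Fin nu → ℝ) → Fin nx → ℝ)
    (Bd : Fin nx → ℝ) (hBd : Bd ≠ 0)
    (h : (Fin nx → ℝ) × (Fin nu → ℝ) → Fin nh → ℝ)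
    (hH : (Fin nx → ℝ) → Fin nf → ℝ)
    -- continuous kernel, its RKHS, and the true residual with bounded RKHS norm
    (k : (Fin nx → ℝ) × (Fin nu → ℝ) → (Fin nx → ℝ) × (Fin nu → ℝ) → ℝ)
    (hk : Continuous (Function.uncurry k))
    {ℋ : Type*} [NormedAddCommGroup ℋ] [InnerProductSpace ℝ ℋ] [CompleteSpace ℋ]
    [RKHS ℝ ℋ ((Fin nx → ℝ) × (Fin nu → ℝ)) ℝ]
    (hkernel : ∀ z z', RKHS.kernel ℋ z z' 1 = k z z')
    (gtr : ℋ) (Bg : ℝ) (hgtr : ‖gtr‖ ≤ Bg)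
    -- data: input locations may depend on the past, the noise is i.i.d. `N(0, lam²)`
    {Ω : Type*} {mΩ : MeasurableSpace Ω} (P : Measure Ω) [IsProbabilityMeasure P]
    (lam : ℝ) (hlam : 0 < lam) {D : ℕ} (ℱ : Filtration ℕ mΩ)
    (S : Set ((Fin nx → ℝ) × (Fin nu → ℝ)))
    (Z : Fin D → Ω → (Fin nx → ℝ) × (Fin nu → ℝ)) (hZS : ∀ i ω, Z i ω ∈ S)
    (hZ : ∀ i : Fin D, Measurable[ℱ (i : ℕ)] (Z i))
    (ε : Fin D → Ω → ℝ) (hε : ∀ i : Fin D, Measurable[ℱ ((i : ℕ) + 1)] (ε i))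
    (hεlaw : ∀ i, HasLaw (ε i) (gaussianReal 0 (Real.toNNReal (lam ^ 2))) P)
    (hεindep : ∀ i : Fin D, Indep (MeasurableSpace.comap (ε i) inferInstance) (ℱ (i : ℕ)) P)
    (Y : Ω → Fin D → ℝ) (hY : ∀ ω i, Y ω i = measurement f Bd gtr (Z i ω) (ε i ω))
    -- confidence level and confidence scaling
    (p : ℝ) (hp0 : 0 < p) (hp1 : p < 1)
    (hγ : BddAbove (infoGains k lam S D))
    (β : ℝ) (hβ : Bg + √(2 * (maxInfoGain k lam S D + 1 + Real.log (1 / p))) ≤ √β)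
    -- horizon and stage costs
    (H : ℕ) (l : Fin H → (Fin nx → ℝ) × (Fin nu → ℝ) → ℝ) :
    ∃ E : Set Ω, MeasurableSet E ∧ ENNReal.ofReal (1 - p) ≤ P E ∧ ∀ ω ∈ E,
      -- whenever the terminal set is robustly positively invariant with the input `uf`,
      ∀ uf : Fin nu → ℝ,
      IsRobustInvariant f Bd
        (confSet k lam β (fun i => Z i ω) (Y ω) (sublevel h)) (sublevel h) (sublevel hH) uf →
      -- and `u` is optimal for the robust problem posed at `x₀` with the truncated posterior,
      ∀ (ν : Measure ((Fin nx → ℝ) × (Fin nu → ℝ) → ℝ)),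
      IsGPLaw (postMean k lam (fun i => Z i ω) (Y ω)) (postCov k lam (fun i => Z i ω)) ν →
      ∀ (x₀ : Fin nx → ℝ) (u : Fin H → Fin nu → ℝ),
      IsOptimal f Bd (confSet k lam β (fun i => Z i ω) (Y ω) (sublevel h))
        (sublevel h) (sublevel hH) ν l x₀ u →
      -- the true system started at `x₀` satisfies the constraints for all times
      ∀ x : ℕ → Fin nx → ℝ, x 0 = x₀ →
      (∀ t, x (t + 1) = stepDyn f Bd gtr (x t) (appliedInput u uf t)) →
      ∀ t, (x t, appliedInput u uf t) ∈ sublevel h := by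
  have hkm : Measurable (Function.uncurry k) := hk.measurable
  have hpsd := kernel_posSemidef hkernel
  have hsymm := kernel_symm hkernel
  have hZm (i : Fin D) : Measurable (Z i) := (hZ i).mono (ℱ.le _) le_rfl
  have hεm (i : Fin D) : Measurable (ε i) := (hε i).mono (ℱ.le _) le_rfl
  have hRm : Measurable fun ω => likelihoodRatio k lam (fun i => Z i ω) (fun i => ε i ω) :=
    measurable_likelihoodRatio hkm hZm hεm
  -- The event involves only locations and noise, so it is fixed before `uf`, `x₀` and `u` are
  -- chosen, and the conclusion is uniform in them.
  refine ⟨{ω | likelihoodRatio k lam (fun i => Z i ω) (fun i => ε i ω) < 1 / p},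
    measurableSet_lt hRm measurable_const,
    ofReal_one_sub_le_measure_lt_inv P hRm
      (lintegral_likelihoodRatio hkm hpsd hsymm hlam P ℱ Z hZ ε hε hεlaw hεindep) hp0, ?_⟩
  intro ω hω uf hinv ν _ x₀ u hopt x hx0 hx t
  refine hopt.1.closedLoop hinv (fun z _ => ?_) hx0 hx t
  have hQ := noiseQuadForm_le hpsd hlam _ _ hω
  have hgain : infoGain k lam (fun i => Z i ω) ≤ maxInfoGain k lam S D :=
    le_csSup hγ ⟨_, fun i => hZS i ω, rfl⟩
  -- The bound on Q is 2(γ_D + log(1/p)); the extra 1 in the condition on β is slack.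
  have hscale : ‖gtr‖ + √(noiseQuadForm k lam (fun i => Z i ω) (fun i => ε i ω)) ≤ √β :=
    (add_le_add hgtr (Real.sqrt_le_sqrt (by linarith))).trans hβ
  have hYω : Y ω = fun i => gtr (Z i ω) + ε i ω :=
    funext fun i => (hY ω i).trans (measurement_eq hBd _ _ _)
  have hdev := (abs_sub_postMean_le hkernel hlam gtr (fun i => Z i ω) (fun i => ε i ω) z).trans
    (mul_le_mul_of_nonneg_right hscale (Real.sqrt_nonneg _))
  rw [← hYω, abs_le] at hdev
  constructor <;> linarith [hdev.1, hdev.2]
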